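/- Let $k$ be a field, $S=k[x_1,\dots,x_n]$ with its $\mathbf Z^n$-grading, $B\subset S$ an ideal generated by square-free monomials, and $0\to M\to \mathbf Z^n\xrightarrow{\ \phi\ }\mathbf D\to 0$ an exact sequence of abelian groups. For a $\mathbf Z^n$-graded module $N$ and $\delta\in\mathbf D$ put $N_\delta=\bigoplus_{p\in\phi^{-1}(\delta)}N_p$. For an integer $\ell\ge 0$ let $B^{[\ell]}$ be the ideal generated by the $\ell$-th powers of the monomials in $B$. For $I\subseteq\{1,\dots,n\}$ let $L_I\subset\mathbf Z^n$ be the set of the $p$ with $\{j: p_j<0\}=I$, let $C_I=\{p\in\mathbf Z^n : p_j\le 0 \text{ for } j\in I,\ p_j\ge 0\text{ for }j\notin I\}$, and let $p_I$ be the vector with coordinates $-1$ for $j\in I$ and $0$ for $j\notin I$. Fix an integer $i\ge 0$ and let $\Sigma_i$ be the set of all $I$ such that $H^i_B(S)_p\ne 0$ for $p\in L_I$. Assume that $H^i_B(S)_\delta$ is a finite-dimensional $k$-vector space for every $\delta\in\mathbf D$. (1) Let $I\in\Sigma_i$ and $p\in\mathbf Z^n$. The set of the $x\in\mathbf R^n$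 with $x\in p+\mathbf R M$, $x_j\le -1$ for $j\in I$ and $x_j\ge 0$ for $j\notin I$ is a bounded polyhedron, and $(p+M)\cap(p_I+C_I)$ is the set of those points of $p+M$ that lie in it. (2) Let $\delta\in\mathbf D$ and let $p\in\mathbf Z^n$ be any representative of $\delta$. For $I\in\Sigma_i$ and $j\in I$ let $f_{I,j}(\delta)$ be the maximum of $0$ and of the negative of the minimum of the $j$-th coordinates of the points of $(p+M)\cap(p_I+C_I)$ (so that $f_{I,j}(\delta)=0$ if there are no such points). Then, for every integer $\ell\ge 0$, the natural map $$\mathrm{Ext}^i_S(S/B^{[\ell]},S)_\delta\longrightarrow H^i_B(S)_\delta$$ is an isomorphism if and only if $\ell\ge \max\{f_{I,j}(\delta) : I\in\Sigma_i,\ j\in I\}$ (the maximum over the empty set being $0$). -/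

import Mathlib

open CategoryTheory MvPolynomial

universe u

namespace CoarseLC

noncomputable section

/-! ### Sign patterns, orthants, lattice slices -/

section Orthants

variable {n : ℕ}

/-- The set `neg p` of indices of the negative coordinates of `p ∈ ℤⁿ`. -/
def negSupport (p : Fin n → ℤ) : Finset (Fin n) := Finset.univ.filter fun j => p j < 0

/-- `L_I`, the set of degrees whose negative coordinates are exactly those in `I`. -/
def signCell (I : Finset (Fin n)) : Set (Fin n → ℤ) := {p | negSupport p = I}

/-- The orthant `C_I ⊆ ℤⁿ`: nonpositive coordinates on `I`, nonnegative ones off `I`. -/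
def orthant (I : Finset (Fin n)) : Set (Fin n → ℤ) :=
  {p | ∀ j, (j ∈ I → p j ≤ 0) ∧ (j ∉ I → 0 ≤ p j)}

/-- The vector `p_I`, equal to `-1` on `I` and to `0` off `I`. -/
def corner (I : Finset (Fin n)) : Fin n → ℤ := fun j => if j ∈ I then -1 else 0

/-- The set `(p + M) ∩ (p_I + C_I)`. -/
def slice (M : AddSubgroup (Fin n → ℤ)) (p : Fin n → ℤ) (I : Finset (Fin n)) :
    Set (Fin n → ℤ) :=
  {q | q - p ∈ M} ∩ {q | q - corner I ∈ orthant I}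

/-- The number `f_{I,j}`: the maximum of `0` and of the negative of the least `j`-th coordinate of
a point of `(p + M) ∩ (p_I + C_I)`. It is `0` when there is no such point. -/
def coordBound (M : AddSubgroup (Fin n → ℤ)) (p : Fin n → ℤ) (I : Finset (Fin n)) (j : Fin n) :
    ℤ :=
  max 0 (-sInf ((fun q : Fin n → ℤ => q j) '' slice M p I))

/-- The inclusion `ℤⁿ ⊆ ℝⁿ`. -/
def toReal (q : Fin n → ℤ) : Fin n → ℝ := fun j => (q j : ℝ)

/-- A polyhedron in `ℝⁿ`: an intersection of finitely many closed half-spaces. -/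
def IsPolyhedron (P : Set (Fin n → ℝ)) : Prop :=
  ∃ H : Finset (((Fin n → ℝ) →ₗ[ℝ] ℝ) × ℝ), P = {x | ∀ h ∈ H, h.1 x ≤ h.2}

/-- The real counterpart of `slice`: the intersection in `ℝⁿ` of the affine subspace
`p + ℝM` with the real orthant with vertex `p_I`. -/
def realSlice (M : AddSubgroup (Fin n → ℤ)) (p : Fin n → ℤ) (I : Finset (Fin n)) :
    Set (Fin n → ℝ) :=
  {x | x - toReal p ∈ Submodule.span ℝ (toReal '' (M : Set (Fin n → ℤ)))} ∩
    {x | ∀ j, (j ∈ I → x j ≤ -1) ∧ (j ∉ I → 0 ≤ x j)}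

end Orthants

/-! ### Monomial ideals -/

section Ideals

variable {k : Type u} [Field k] {n : ℕ}

/-- Ideals of `k[x₁, …, xₙ]` generated by monomials. -/
def IsMonomialIdeal (J : Ideal (MvPolynomial (Fin n) k)) : Prop :=
  ∃ A : Set (Fin n →₀ ℕ), J = Ideal.span ((fun a => monomial a (1 : k)) '' A)

/-- Ideals of `k[x₁, …, xₙ]` generated by square-free monomials. -/
def IsSquarefreeMonomialIdeal (B : Ideal (MvPolynomial (Fin n) k)) : Prop :=
  ∃ F : Set (Finset (Fin n)),
    B = Ideal.span ((fun J => ∏ j ∈ J, (X j : MvPolynomial (Fin n) k)) '' F)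

/-- `B^[ℓ]`, the ideal generated by the `ℓ`-th powers of the monomials in `B`. -/
def bracketPower (B : Ideal (MvPolynomial (Fin n) k)) (l : ℕ) : Ideal (MvPolynomial (Fin n) k) :=
  Ideal.span {f | ∃ a : Fin n →₀ ℕ, monomial a (1 : k) ∈ B ∧ f = monomial a (1 : k) ^ l}

lemma bracketPower_isMonomialIdeal (B : Ideal (MvPolynomial (Fin n) k)) (l : ℕ) :
    IsMonomialIdeal (bracketPower B l) := by
  refine ⟨{b | ∃ a : Fin n →₀ ℕ, monomial a (1 : k) ∈ B ∧ b = l • a}, ?_⟩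
  unfold bracketPower
  congr 1
  ext f
  constructor
  · rintro ⟨a, ha, rfl⟩
    exact ⟨l • a, ⟨a, ha, rfl⟩, by simp [monomial_pow]⟩
  · rintro ⟨_, ⟨a, ha, rfl⟩, rfl⟩
    exact ⟨a, ha, by simp [monomial_pow]⟩

lemma IsSquarefreeMonomialIdeal.le_radical_bracketPower {B : Ideal (MvPolynomial (Fin n) k)}
    (hB : IsSquarefreeMonomialIdeal B) (l : ℕ) : B ≤ (bracketPower B l).radical := by
  obtain ⟨F, hF⟩ := hB
  conv_lhs => rw [hF]
  rw [Ideal.span_le]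
  rintro _ ⟨J, hJ, rfl⟩
  have e : (∏ j ∈ J, (X j : MvPolynomial (Fin n) k)) =
      monomial (∑ j ∈ J, Finsupp.single j 1) (1 : k) := by
    rw [monomial_sum_one]
    rfl
  refine ⟨l, Ideal.subset_span ⟨∑ j ∈ J, Finsupp.single j 1, ?_, by rw [← e]⟩⟩
  rw [← e, hF]
  exact Ideal.subset_span ⟨J, hJ, rfl⟩

end Ideals

/-! ### `ℤⁿ`-graded modules -/

section Graded

variable (k : Type u) [Field k] (n : ℕ)

/-- The set `ℤⁿ` of degrees, viewed as a poset (with the coordinatewise order), and hence as a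
category with one morphism `q ⟶ q'` whenever `q ≤ q'`. -/
def DegreePoset (n : ℕ) : Type := Fin n → ℤ

instance (n : ℕ) : PartialOrder (DegreePoset n) := inferInstanceAs (PartialOrder (Fin n → ℤ))

/-- The category of `ℤⁿ`-graded modules over `S = k[x₁, …, xₙ]` (with its fine grading) and degree
preserving `S`-linear maps. Such a module is a family of `k`-vector spaces `N_q`, `q ∈ ℤⁿ`, with
commuting multiplications `x_j : N_q → N_{q + e_j}`, that is to say a functor from the poset `ℤⁿ` to
`k`-vector spaces: for `q ≤ q'`, the map `N_q → N_{q'}` is the multiplication by the monomial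
`x^(q' - q)`. -/
abbrev GrMod := DegreePoset n ⥤ ModuleCat.{u} k

instance : HasExt.{u + 1} (GrMod k n) := HasExt.standard _

variable {k n}

/-- The translation `q ↦ p + q` of the poset `ℤⁿ`. -/
def translate (p : Fin n → ℤ) (q : DegreePoset n) : DegreePoset n := fun j => p j + q j

lemma translate_monotone (p : Fin n → ℤ) : Monotone (translate p) :=
  fun _ _ h j => add_le_add_right (h j) (p j)

/-- The graded module `N(p)` with `N(p)_q = N_{p + q}`. -/
def twist (p : Fin n → ℤ) (N : GrMod k n) : GrMod k n :=
  (translate_monotone p).functor ⋙ N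

/-- The exponent of the monomial `x^(q' - q)`, for `q ≤ q'`. -/
def expDiff (q q' : Fin n → ℤ) : Fin n →₀ ℕ :=
  Finsupp.equivFunOnFinite.symm fun j => (q' j - q j).toNat

/-- An `S`-module `N` with homogeneous components `𝒩 q`, `q ∈ ℤⁿ`, permuted by the monomials in
the way that a grading requires, as an object of `GrMod k n`. -/
def ofPieces {N : Type u} [AddCommGroup N] [Module k N] [Module (MvPolynomial (Fin n) k) N]
    [IsScalarTower k (MvPolynomial (Fin n) k) N] (𝒩 : (Fin n → ℤ) → Submodule k N)
    (h : ∀ (a : Fin n →₀ ℕ) (q q' : Fin n → ℤ), (∀ j, q' j = q j + a j) →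
      ∀ x ∈ 𝒩 q, monomial a (1 : k) • x ∈ 𝒩 q') : GrMod k n where
  obj q := ModuleCat.of k (𝒩 q)
  map {q q'} w := ModuleCat.ofHom <|
    (Algebra.lsmul k k N (monomial (expDiff q q') (1 : k))).restrict (p := 𝒩 q) (q := 𝒩 q')
      fun x hx => h _ q q' (fun j => by
        have : q j ≤ q' j := w.le j
        simp [expDiff]
        omega) x hx
  map_id q := by
    ext x
    have : expDiff q q = 0 := by ext; simp [expDiff]
    simp [this]
  map_comp {q q' q''} w w' := by
    ext x
    have : expDiff q q'' = expDiff q' q'' + expDiff q q' := by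
      ext j
      have : q j ≤ q' j := w.le j
      have : q' j ≤ q'' j := w'.le j
      simp [expDiff]
      omega
    change monomial (expDiff q q'') (1 : k) • (x : N) =
      monomial (expDiff q' q'') (1 : k) • monomial (expDiff q q') (1 : k) • (x : N)
    rw [this, smul_smul, monomial_mul, one_mul]

/-- The component of degree `q ∈ ℤⁿ` of `S`, spanned by `x^q` if `q ≥ 0`, and `0` otherwise. -/
def polyPiece (q : Fin n → ℤ) : Submodule k (MvPolynomial (Fin n) k) :=
  Submodule.span k {f | ∃ a : Fin n →₀ ℕ, (∀ j, q j = a j) ∧ f = monomial a (1 : k)}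

lemma monomial_smul_mem_polyPiece (a : Fin n →₀ ℕ) (q q' : Fin n → ℤ)
    (hq : ∀ j, q' j = q j + a j) (x : MvPolynomial (Fin n) k) (hx : x ∈ polyPiece (k := k) q) :
    monomial a (1 : k) • x ∈ polyPiece (k := k) q' := by
  induction hx using Submodule.span_induction with
  | mem x hx =>
    obtain ⟨b, hb, rfl⟩ := hx
    exact Submodule.subset_span ⟨a + b, fun j => by simp [hq, hb, add_comm],
      by simp [monomial_mul]⟩
  | zero => simp
  | add x y _ _ hx hy => rw [smul_add]; exact add_mem hx hy
  | smul c x _ hx => rw [smul_comm]; exact Submodule.smul_mem _ _ hx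

/-- The component of degree `q` of `S/J`: the image of the component of degree `q` of `S`. -/
def quotPiece (J : Ideal (MvPolynomial (Fin n) k)) (q : Fin n → ℤ) :
    Submodule k (MvPolynomial (Fin n) k ⧸ J) :=
  (polyPiece q).map (Ideal.Quotient.mkₐ k J).toLinearMap

lemma monomial_smul_mem_quotPiece (J : Ideal (MvPolynomial (Fin n) k)) (a : Fin n →₀ ℕ)
    (q q' : Fin n → ℤ) (hq : ∀ j, q' j = q j + a j) (x : MvPolynomial (Fin n) k ⧸ J)
    (hx : x ∈ quotPiece J q) : monomial a (1 : k) • x ∈ quotPiece J q' := by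
  obtain ⟨y, hy, rfl⟩ := hx
  exact ⟨monomial a (1 : k) • y, monomial_smul_mem_polyPiece a q q' hq y hy, rfl⟩

variable (k n) in
/-- The polynomial ring `S`, as a graded module. -/
def polyRing : GrMod k n := ofPieces (N := MvPolynomial (Fin n) k) polyPiece
  monomial_smul_mem_polyPiece

/-- The quotient `S/J` of `S` by a monomial ideal, as a graded module. -/
def quotRing (J : Ideal (MvPolynomial (Fin n) k)) : GrMod k n :=
  ofPieces (quotPiece J) (monomial_smul_mem_quotPiece J)

/-- The projection `S/J → S/J'` for `J ≤ J'`. -/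
def quotMap {J J' : Ideal (MvPolynomial (Fin n) k)} (h : J ≤ J') : quotRing J ⟶ quotRing J' where
  app q := ModuleCat.ofHom <|
    (Ideal.Quotient.factorₐ k h).toLinearMap.restrict (p := quotPiece J q) (q := quotPiece J' q) (by
      rintro _ ⟨y, hy, rfl⟩
      exact ⟨y, hy, rfl⟩)
  naturality q q' w := by
    ext x
    obtain ⟨_, y, hy, rfl⟩ := x
    rfl

/-! ### Graded `Ext` and graded local cohomology -/

/-- The component of degree `p ∈ ℤⁿ` of the graded module `Ext^i_S(S/J, S)`: classes of extensions
of degree `p`, that is `Ext^i` from `S/J` to `S(p)` in the category of graded modules. -/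
abbrev extPiece (J : Ideal (MvPolynomial (Fin n) k)) (i : ℕ) (p : Fin n → ℤ) : Type (u + 1) :=
  Abelian.Ext (quotRing J) (twist p (polyRing k n)) i

/-- The map `Ext^i(S/J', S)_p → Ext^i(S/J, S)_p` induced by the projection `S/J → S/J'`. -/
def extTransition {J J' : Ideal (MvPolynomial (Fin n) k)} (h : J ≤ J') (i : ℕ) (p : Fin n → ℤ) :
    extPiece J' i p →ₗ[k] extPiece J i p :=
  (Abelian.Ext.mk₀ (quotMap h)).precompOfLinear k (twist p (polyRing k n)) (zero_add i)

/-- The monomial ideals whose radical contains `B`. Any sequence of monomial ideals that is cofinal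
with the powers of `B` is cofinal among them. -/
abbrev SupportIdeal (B : Ideal (MvPolynomial (Fin n) k)) : Type u :=
  {J : Ideal (MvPolynomial (Fin n) k) // IsMonomialIdeal J ∧ B ≤ J.radical}

open Classical in
/-- The component `H^i_B(S)_p` of degree `p ∈ ℤⁿ` of local cohomology: the direct limit of the
`Ext^i(S/J, S)_p`, as the monomial ideal `J` with `B ≤ √J` decreases. -/
abbrev lcPiece (B : Ideal (MvPolynomial (Fin n) k)) (i : ℕ) (p : Fin n → ℤ) : Type (u + 1) :=
  Module.DirectLimit (R := k) (ι := (SupportIdeal B)ᵒᵈ)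
    (fun J => extPiece (OrderDual.ofDual J).1 i p)
    (fun J J' h => extTransition (J := (OrderDual.ofDual J').1) (J' := (OrderDual.ofDual J).1) h i p)

/-- `Σ_i`, the set of the `I` such that `H^i_B(S)_p ≠ 0` for `p ∈ L_I`. -/
def sigmaSet (B : Ideal (MvPolynomial (Fin n) k)) (i : ℕ) : Set (Finset (Fin n)) :=
  {I | ∀ p ∈ signCell I, Nontrivial (lcPiece B i p)}

open Classical in
/-- The natural map `Ext^i(S/B^[ℓ], S)_p → H^i_B(S)_p`. -/
def toLC {B : Ideal (MvPolynomial (Fin n) k)} (hB : IsSquarefreeMonomialIdeal B) (l i : ℕ)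
    (p : Fin n → ℤ) : extPiece (bracketPower B l) i p →ₗ[k] lcPiece B i p :=
  Module.DirectLimit.of k (SupportIdeal B)ᵒᵈ
    (fun J => extPiece (OrderDual.ofDual J).1 i p)
    (fun J J' h => extTransition (J := (OrderDual.ofDual J').1) (J' := (OrderDual.ofDual J).1) h i p)
    (OrderDual.toDual
      ⟨bracketPower B l, bracketPower_isMonomialIdeal B l, hB.le_radical_bracketPower l⟩)

/-! ### The coarse grading: `N_δ = ⨁ N_p` over the `p` with `φ p = δ` -/

variable {D : Type*} [AddCommGroup D]

/-- `Ext^i(S/J, S)_δ`. -/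
abbrev extCoarse (φ : (Fin n → ℤ) →+ D) (J : Ideal (MvPolynomial (Fin n) k)) (i : ℕ) (δ : D) :
    Type (u + 1) :=
  DirectSum {p : Fin n → ℤ // φ p = δ} fun p => extPiece J i p.1

/-- `H^i_B(S)_δ`. -/
abbrev lcCoarse (φ : (Fin n → ℤ) →+ D) (B : Ideal (MvPolynomial (Fin n) k)) (i : ℕ) (δ : D) :
    Type (u + 1) :=
  DirectSum {p : Fin n → ℤ // φ p = δ} fun p => lcPiece B i p.1

/-- The natural map `Ext^i(S/B^[ℓ], S)_δ → H^i_B(S)_δ`. -/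
def toLCCoarse (φ : (Fin n → ℤ) →+ D) {B : Ideal (MvPolynomial (Fin n) k)}
    (hB : IsSquarefreeMonomialIdeal B) (l i : ℕ) (δ : D) :
    extCoarse φ (bracketPower B l) i δ →ₗ[k] lcCoarse φ B i δ :=
  DirectSum.lmap fun p => toLC hB l i p.1

end Graded

end

end CoarseLC

universe w

namespace CoarseLC

noncomputable section

/-! ### Enough projectives in functor categories -/

section EnoughProjectives

open Limits

variable {C : Type*} [Category* C] {A : Type*} [Category* A]

/-! Everything is decided in each fine degree `p`, where the `Ext` piece is `Ext^i(S/B^[l], S(p))`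
in the functor category. The point is that all the `S/B^[l]` are pullbacks of one interval module on
`Cube n`, along the monotone maps `collapse l t`. Such a map has a left adjoint `stretch l t`, so
pullback along it is exact, preserves projectives, and is left adjoint to pullback along `stretch l
t`. By dimension shifting, these `Ext` groups see only the values of `S(p)` at the points `stretch l
t s`, which on each coordinate are negative, `0` or `l`.

Three consequences follow by inspecting signs. If some `p_j < -l`, all these values vanish and so
does `Ext` (`extPiece_subsingleton`). If `p ≥ -l`, raising `l` changes nothing
(`extTransition_bijective`), so the map to local cohomology is bijective, bracket powers being
cofinal (`toLC_bijective`). If `p ≤ p'` have the same negative support and `p ≥ -l`, multiplication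
by `x^(p' - p)` is bijective on `Ext` (`nontrivial_extPiece_iff`), so nonvanishing of local
cohomology depends only on the sign pattern.

Hence the coarse map is bijective iff every `q` over `δ` with negative support in `Σ_i` satisfies `q
≥ -l` (`toLCCoarse_bijective_iff`). Finite dimension makes the slices finite, so the minima defining
`coordBound` are attained. Boundedness of the real slice follows by rounding its points to lattice
points. -/

lemma projective_sigma {β : Type*} (P : β → C) [HasCoproduct P] (h : ∀ b, Projective (P b)) :
    Projective (∐ P) where
  factors f e _ := ⟨Sigma.desc fun b => Projective.factorThru (Sigma.ι P b ≫ f) e, by cat_disch⟩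

/-- The left adjoint of evaluation at `c` preserves projectives because evaluation preserves
epimorphisms. The coproduct over `c` of its values on projective covers of `X.obj c` is projective
and surjects onto `X` at every `c`. -/
lemma enoughProjectives_functor [EnoughProjectives A] [HasPushouts A]
    [∀ a b : C, HasCoproductsOfShape (a ⟶ b) A] [HasCoproductsOfShape C A] :
    EnoughProjectives (C ⥤ A) where
  presentation X := by
    let adj (c : C) := evaluationAdjunctionRight A c
    let P (c : C) : C ⥤ A := (evaluationLeftAdjoint A c).obj (Projective.over (X.obj c))
    let f (c : C) : P c ⟶ X := ((adj c).homEquiv _ _).symm (Projective.π (X.obj c))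
    have hP (c : C) : Projective (P c) := (adj c).map_projective _ inferInstance
    have hf : Epi (Limits.Sigma.desc f) := by
      refine ⟨fun {Z} g h e => ?_⟩
      apply NatTrans.ext
      funext c
      have e' : f c ≫ g = f c ≫ h := by
        simpa using congrArg (fun t => Limits.Sigma.ι P c ≫ t) e
      rw [← cancel_epi (Projective.π (X.obj c))]
      have e'' := congrArg ((adj c).homEquiv _ _) e'
      simp only [Adjunction.homEquiv_naturality_right, f, Equiv.apply_symm_apply] at e''
      exact e''
    exact ⟨{ p := ∐ P, f := Limits.Sigma.desc f, projective := projective_sigma P hP, epi := hf }⟩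

end EnoughProjectives

/-! ### Dimension shifting along exact functors preserving projectives -/

section DimensionShifting

open Abelian

variable {C : Type*} [Category* C] [Abelian C] [EnoughProjectives C]
  {D : Type*} [Category* D] [Abelian D]

/-- The beginning of a projective resolution. -/
def syzygy (X : C) : ShortComplex C :=
  ShortComplex.mk (Limits.kernel.ι (Projective.π X)) (Projective.π X) (by simp)

lemma syzygy_shortExact (X : C) : (syzygy X).ShortExact :=
  { exact := ShortComplex.exact_kernel _
    mono_f := by dsimp [syzygy]; infer_instance
    epi_g := by dsimp [syzygy]; infer_instance }

variable (F : C ⥤ D) [F.Additive] [Limits.PreservesFiniteLimits F]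
  [Limits.PreservesFiniteColimits F]

lemma syzygy_map_shortExact (X : C) : ((syzygy X).map F).ShortExact :=
  (syzygy_shortExact X).map_of_exact F

variable [HasExt.{u} D]

/-- The class of the extension `0 ⟶ F K ⟶ F P ⟶ F X ⟶ 0` given by the syzygy of `X`. -/
def syzygyClass (X : C) : Ext (F.obj X) (F.obj (syzygy X).X₁) 1 :=
  (syzygy_map_shortExact F X).extClass

lemma exists_mk₀_comp_eq (X : C) {Y : D} {i : ℕ} (e : Ext (F.obj (syzygy X).X₁) Y i)
    (he : (syzygyClass F X).comp e (add_comm 1 i) = 0) :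
    ∃ e' : Ext (F.obj (syzygy X).X₂) Y i,
      (Ext.mk₀ (F.map (syzygy X).f)).comp e' (zero_add i) = e :=
  Ext.contravariant_sequence_exact₁ (syzygy_map_shortExact F X) Y e (add_comm 1 i) he

lemma syzygyClass_comp_mk₀_comp (X : C) {Y : D} {i : ℕ} (e : Ext (F.obj (syzygy X).X₂) Y i) :
    (syzygyClass F X).comp ((Ext.mk₀ (F.map (syzygy X).f)).comp e (zero_add i)) (add_comm 1 i) = 0 :=
  (syzygy_map_shortExact F X).extClass_comp_assoc e

/-- Naturality of the connecting class; it lets the dimension shifts for `F'` and `F` be compared.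
-/
lemma syzygyClass_comp_mk₀_app {F F' : C ⥤ D} [F.Additive] [Limits.PreservesFiniteLimits F]
    [Limits.PreservesFiniteColimits F] [F'.Additive] [Limits.PreservesFiniteLimits F']
    [Limits.PreservesFiniteColimits F'] (τ : F' ⟶ F) (X : C) :
    (syzygyClass F' X).comp (Ext.mk₀ (τ.app (syzygy X).X₁)) (add_zero 1) =
      (Ext.mk₀ (τ.app X)).comp (syzygyClass F X) (zero_add 1) :=
  ShortComplex.ShortExact.extClass_naturality (syzygy_map_shortExact F' X)
    (syzygy_map_shortExact F X) ((syzygy X).mapNatTrans τ)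

variable [F.PreservesProjectiveObjects]

/-- `F` sends the projective cover to a projective object, whose `Ext` vanishes in the positive
degree `i + 1`; exactness of the long sequence then gives the factorization. -/
lemma exists_syzygyClass_comp_eq (X : C) {Y : D} {i : ℕ} (e : Ext (F.obj X) Y (i + 1)) :
    ∃ e' : Ext (F.obj (syzygy X).X₁) Y i, (syzygyClass F X).comp e' (add_comm 1 i) = e :=
  have : Projective ((syzygy X).map F).X₂ := F.projective_obj (Projective.over X)
  Ext.contravariant_sequence_exact₃ (syzygy_map_shortExact F X) Y e
    (Ext.eq_zero_of_projective _) (add_comm 1 i)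

/-- If there are no maps to `Y` from the image of `F`, then there are no extensions either. -/
theorem subsingleton_ext_of_hom {Y : D} (h : ∀ (X : C) (f : F.obj X ⟶ Y), f = 0) (i : ℕ) :
    ∀ X : C, Subsingleton (Ext (F.obj X) Y i) := by
  induction i with
  | zero =>
    intro X
    have : Subsingleton (F.obj X ⟶ Y) := ⟨fun f g => (h X f).trans (h X g).symm⟩
    exact Ext.homEquiv₀.subsingleton
  | succ i ih =>
    intro X
    refine subsingleton_of_forall_eq 0 fun e => ?_
    obtain ⟨e', rfl⟩ := exists_syzygyClass_comp_eq F X e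
    rw [(ih _).elim e' 0, Ext.comp_zero]

/-- If `g : Y ⟶ Y'` induces bijections on the maps from the image of `F`, then it does so on
extensions. -/
theorem bijective_ext_postcomp_of_hom {Y Y' : D} (g : Y ⟶ Y')
    (h : ∀ X : C, Function.Bijective fun f : F.obj X ⟶ Y => f ≫ g) (i : ℕ) :
    ∀ X : C, Function.Bijective fun e : Ext (F.obj X) Y i =>
      e.comp (Ext.mk₀ g) (add_zero i) := by
  induction i with
  | zero =>
    intro X
    have e : (fun e : Ext (F.obj X) Y 0 => e.comp (Ext.mk₀ g) (add_zero 0)) =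
        Ext.homEquiv₀.symm ∘ (fun f : F.obj X ⟶ Y => f ≫ g) ∘ Ext.homEquiv₀ := by
      funext e
      obtain ⟨f, rfl⟩ := Ext.homEquiv₀.symm.surjective e
      simp [Ext.homEquiv₀]
    rw [e]
    exact Ext.homEquiv₀.symm.bijective.comp ((h X).comp Ext.homEquiv₀.bijective)
  | succ i ih =>
    intro X
    constructor
    · let φ := (Ext.mk₀ g).postcomp (F.obj X) (add_zero (i + 1))
      change Function.Injective φ
      refine (injective_iff_map_eq_zero φ).2 ?_
      intro e he
      change e.comp (Ext.mk₀ g) (add_zero (i + 1)) = 0 at he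
      obtain ⟨e, rfl⟩ := exists_syzygyClass_comp_eq F X e
      -- A diagram chase as in the five lemma: surjectivity in degree `i` for the projective term
      -- and injectivity for the syzygy show that `e` extends to the projective term, hence is
      -- killed by the syzygy class.
      rw [Ext.comp_assoc_of_third_deg_zero] at he
      obtain ⟨e', he'⟩ := exists_mk₀_comp_eq F X _ he
      obtain ⟨e'', rfl⟩ := (ih _).2 e'
      dsimp only at he'
      rw [← Ext.comp_assoc_of_third_deg_zero] at he'
      rw [← (ih _).1 he']
      exact syzygyClass_comp_mk₀_comp F X e''
    · intro e
      obtain ⟨e, rfl⟩ := exists_syzygyClass_comp_eq F X e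
      obtain ⟨e, rfl⟩ := (ih _).2 e
      exact ⟨_, Ext.comp_assoc_of_third_deg_zero _ _ _ _⟩

variable {F} {F' : C ⥤ D} [F'.Additive] [Limits.PreservesFiniteLimits F']
  [Limits.PreservesFiniteColimits F'] [F'.PreservesProjectiveObjects]

/-- If the natural transformation `τ : F' ⟶ F` induces bijections on maps to `Y`, then it does so
on extensions. -/
theorem bijective_ext_precomp_of_hom (τ : F' ⟶ F) {Y : D}
    (h : ∀ X : C, Function.Bijective fun f : F.obj X ⟶ Y => τ.app X ≫ f) (i : ℕ) :
    ∀ X : C, Function.Bijective fun e : Ext (F.obj X) Y i =>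
      (Ext.mk₀ (τ.app X)).comp e (zero_add i) := by
  induction i with
  | zero =>
    intro X
    have e : (fun e : Ext (F.obj X) Y 0 => (Ext.mk₀ (τ.app X)).comp e (zero_add 0)) =
        Ext.homEquiv₀.symm ∘ (fun f : F.obj X ⟶ Y => τ.app X ≫ f) ∘ Ext.homEquiv₀ := by
      funext e
      obtain ⟨f, rfl⟩ := Ext.homEquiv₀.symm.surjective e
      simp [Ext.homEquiv₀]
    rw [e]
    exact Ext.homEquiv₀.symm.bijective.comp ((h X).comp Ext.homEquiv₀.bijective)
  | succ i ih =>
    intro X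
    have key (e : Ext (F.obj (syzygy X).X₁) Y i) :
        (syzygyClass F' X).comp ((Ext.mk₀ (τ.app (syzygy X).X₁)).comp e (zero_add i))
          (add_comm 1 i) =
        (Ext.mk₀ (τ.app X)).comp ((syzygyClass F X).comp e (add_comm 1 i))
          (zero_add (i + 1)) := by
      rw [← Ext.comp_assoc (a₁₂ := 1) _ _ _ (zero_add 1) (add_comm 1 i) (by lia),
        ← syzygyClass_comp_mk₀_app,
        Ext.comp_assoc (a₂₃ := i) _ _ _ (add_zero 1) (zero_add i) (by lia)]
    constructor
    · let φ := (Ext.mk₀ (τ.app X)).precomp Y (zero_add (i + 1))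
      change Function.Injective φ
      refine (injective_iff_map_eq_zero φ).2 ?_
      intro e he
      change (Ext.mk₀ (τ.app X)).comp e (zero_add (i + 1)) = 0 at he
      obtain ⟨e, rfl⟩ := exists_syzygyClass_comp_eq F X e
      rw [← key] at he
      obtain ⟨e', he'⟩ := exists_mk₀_comp_eq F' X _ he
      obtain ⟨e'', rfl⟩ := (ih _).2 e'
      dsimp only at he'
      rw [Ext.mk₀_comp_mk₀_assoc, τ.naturality, ← Ext.mk₀_comp_mk₀_assoc] at he'
      rw [← (ih _).1 he']
      exact syzygyClass_comp_mk₀_comp F X e''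
    · intro e
      obtain ⟨e, rfl⟩ := exists_syzygyClass_comp_eq F' X e
      obtain ⟨e, rfl⟩ := (ih _).2 e
      exact ⟨_, (key e).symm⟩

end DimensionShifting

/-! ### Interval modules -/

section IntervalModule

variable {k : Type u} [Field k]

/-- The submodule of `k` that is everything if `a` holds and zero otherwise. -/
def propPiece (k : Type u) [Field k] (a : Prop) : Submodule k k where
  carrier := {c | ¬ a → c = 0}
  add_mem' hx hy h := by simp [hx h, hy h]
  zero_mem' _ := rfl
  smul_mem' c x hx h := by simp [hx h]

open Classical in
/-- The map between the pieces for `a` and for `b` which is the identity of `k` if `b` holds, and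
zero otherwise. -/
def propPieceMap (k : Type u) [Field k] (a b : Prop) : propPiece k a →ₗ[k] propPiece k b where
  toFun c := ⟨if b then c.1 else 0, fun h => if_neg h⟩
  map_add' x y := by ext; by_cases h : b <;> simp [h]
  map_smul' c x := by ext; by_cases h : b <;> simp [h]

lemma propPieceMap_coe {a b : Prop} (hb : b) (c : propPiece k a) :
    (propPieceMap k a b c : k) = c := if_pos hb

variable {P : Type*} [Preorder P]

/-- The interval module of an order connected set: the functor with value `k` on this set and zero
elsewhere, with identities as transition maps. -/
def intervalModule (k : Type u) [Field k] (A : Set P) (hA : A.OrdConnected) :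
    P ⥤ ModuleCat.{u} k where
  obj q := ModuleCat.of k (propPiece k (q ∈ A))
  map {q q'} _ := ModuleCat.ofHom (propPieceMap k (q ∈ A) (q' ∈ A))
  map_id q := by
    ext c
    by_cases h : q ∈ A
    · exact propPieceMap_coe h c
    · exact ((propPieceMap k (q ∈ A) (q ∈ A) c).2 h).trans (c.2 h).symm
  map_comp {q q' q''} w w' := by
    ext c
    change (propPieceMap k (q ∈ A) (q'' ∈ A) c : k) =
      propPieceMap k (q' ∈ A) (q'' ∈ A) (propPieceMap k (q ∈ A) (q' ∈ A) c)
    by_cases h'' : q'' ∈ A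
    · rw [propPieceMap_coe h'', propPieceMap_coe h'']
      by_cases h' : q' ∈ A
      · rw [propPieceMap_coe h']
      · rw [(propPieceMap k (q ∈ A) (q' ∈ A) c).2 h']
        -- The only place where order connectedness is needed: between two points of `A` no
        -- intermediate point may kill the transition map.
        exact c.2 fun h => h' (hA.out h h'' ⟨w.le, w'.le⟩)
    · rw [Subtype.prop (propPieceMap k (q ∈ A) (q'' ∈ A) c) h'',
        Subtype.prop (propPieceMap k (q' ∈ A) (q'' ∈ A) _) h'']

end IntervalModule

/-! ### The pieces of `S` and of its quotients by monomial ideals -/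

section Pieces

variable {k : Type u} [Field k] {n : ℕ}

/-- The exponent with coordinates `max(q_j, 0)`. -/
def posPart (q : Fin n → ℤ) : Fin n →₀ ℕ := Finsupp.equivFunOnFinite.symm fun j => (q j).toNat

@[simp]
lemma posPart_apply (q : Fin n → ℤ) (j : Fin n) : posPart q j = (q j).toNat := rfl

@[simp]
lemma expDiff_apply (q q' : Fin n → ℤ) (j : Fin n) : expDiff q q' j = (q' j - q j).toNat := rfl

lemma expDiff_add_posPart {q q' : Fin n → ℤ} (hq : ∀ j, 0 ≤ q j) (h : ∀ j, q j ≤ q' j) :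
    expDiff q q' + posPart q = posPart q' := by
  ext j
  have := hq j
  have := h j
  simp
  omega

lemma polyPiece_of_nonneg {q : Fin n → ℤ} (hq : ∀ j, 0 ≤ q j) :
    polyPiece (k := k) q = LinearMap.range (monomial (R := k) (posPart q)) := by
  apply le_antisymm
  · rw [polyPiece, Submodule.span_le]
    rintro _ ⟨a, ha, rfl⟩
    have : posPart q = a := by ext j; simp [ha]
    exact ⟨1, by rw [this]⟩
  · rintro _ ⟨c, rfl⟩
    rw [← mul_one c, ← smul_eq_mul, ← smul_monomial]
    exact Submodule.smul_mem _ _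
      (Submodule.subset_span ⟨posPart q, fun j => by simp [hq j], rfl⟩)

lemma polyPiece_of_not_nonneg {q : Fin n → ℤ} (hq : ¬ ∀ j, 0 ≤ q j) :
    polyPiece (k := k) q = ⊥ := by
  rw [polyPiece, Submodule.span_eq_bot]
  rintro _ ⟨a, ha, rfl⟩
  exact (hq fun j => by simp [ha]).elim

/-- Each piece of `S` is a line or zero, and multiplication by a monomial is injective. Surjectivity
can fail only where the target is nonzero and the source is zero, which `h` excludes. -/
lemma polyRing_map_bijective {q q' : DegreePoset n} (w : q ⟶ q')
    (h : (∀ j, 0 ≤ q' j) → ∀ j, 0 ≤ q j) :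
    Function.Bijective ((polyRing k n).map w).hom := by
  have hw : ∀ j, q j ≤ q' j := w.le
  constructor
  · intro x y hxy
    have hxy' : monomial (expDiff q q') (1 : k) * (x.1 : MvPolynomial (Fin n) k) =
      monomial (expDiff q q') (1 : k) * y.1 := congrArg Subtype.val hxy
    exact Subtype.ext (mul_left_cancel₀ (by simp) hxy')
  · rintro ⟨y, hy⟩
    by_cases hq' : ∀ j, 0 ≤ q' j
    · rw [polyPiece_of_nonneg hq'] at hy
      obtain ⟨c, rfl⟩ := hy
      refine ⟨⟨monomial (posPart q) c, ?_⟩, Subtype.ext ?_⟩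
      · rw [polyPiece_of_nonneg (h hq')]
        exact ⟨c, rfl⟩
      · change monomial (expDiff q q') (1 : k) * monomial (posPart q) c = _
        rw [monomial_mul, one_mul, expDiff_add_posPart (h hq') hw]
    · rw [polyPiece_of_not_nonneg hq'] at hy
      exact ⟨0, Subtype.ext (by rw [map_zero]; exact hy.symm)⟩

lemma polyRing_obj_subsingleton {q : DegreePoset n} (h : ¬ ∀ j, 0 ≤ q j) :
    Subsingleton ((polyRing k n).obj q) := by
  change Subsingleton (polyPiece (k := k) q)
  rw [polyPiece_of_not_nonneg h]
  infer_instance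

variable (J : Ideal (MvPolynomial (Fin n) k))

/-- The map `c ↦ c x^a` from `k` to `S/J`. -/
def monomialQuot (a : Fin n →₀ ℕ) : k →ₗ[k] MvPolynomial (Fin n) k ⧸ J :=
  (Ideal.Quotient.mkₐ k J).toLinearMap ∘ₗ monomial a

lemma monomial_smul_monomialQuot (a b : Fin n →₀ ℕ) (c : k) :
    monomial a (1 : k) • monomialQuot J b c = monomialQuot J (a + b) c := by
  change Ideal.Quotient.mk J (monomial a (1 : k) * monomial b c) = _
  rw [monomial_mul, one_mul]
  rfl

lemma monomial_mem_iff {a : Fin n →₀ ℕ} {c : k} (hc : c ≠ 0) :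
    monomial a c ∈ J ↔ monomial a (1 : k) ∈ J := by
  have key (c d : k) (h : monomial a c ∈ J) : monomial a (d * c) ∈ J := by
    rw [← C_mul_monomial]
    exact J.mul_mem_left _ h
  constructor
  · intro h
    simpa [hc] using key c c⁻¹ h
  · intro h
    simpa using key 1 c h

lemma monomialQuot_eq_zero_iff {a : Fin n →₀ ℕ} {c : k} :
    monomialQuot J a c = 0 ↔ c = 0 ∨ monomial a (1 : k) ∈ J := by
  by_cases hc : c = 0
  · simp [hc]
  · rw [← monomial_mem_iff J hc]
    simp only [hc, false_or]
    exact Ideal.Quotient.eq_zero_iff_mem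

lemma quotPiece_of_nonneg {q : Fin n → ℤ} (hq : ∀ j, 0 ≤ q j) :
    quotPiece J q = LinearMap.range (monomialQuot J (posPart q)) := by
  rw [quotPiece, polyPiece_of_nonneg hq, monomialQuot, LinearMap.range_comp]

lemma quotPiece_of_not_nonneg {q : Fin n → ℤ} (hq : ¬ ∀ j, 0 ≤ q j) :
    quotPiece J q = ⊥ := by
  rw [quotPiece, polyPiece_of_not_nonneg hq, Submodule.map_bot]

/-- The degrees of the monomials that are not in `J`. -/
def standardDegrees : Set (DegreePoset n) :=
  {q | (∀ j, 0 ≤ q j) ∧ monomial (posPart q) (1 : k) ∉ J}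

lemma monomialQuot_mem_quotPiece {a : Prop} {q : DegreePoset n} (h : a → q ∈ standardDegrees J)
    (c : k) (hc : c ∈ propPiece k a) : monomialQuot J (posPart q) c ∈ quotPiece J q := by
  by_cases hq : a
  · rw [quotPiece_of_nonneg J (h hq).1]
    exact ⟨c, rfl⟩
  · rw [hc hq, map_zero]
    exact zero_mem _

/-- Where `a` holds and `b` fails, the map to the piece for `b` discards `c`; nothing is lost, since
the monomial then lies in `J`. Keeping `a` an arbitrary proposition serves both a change of degree
and a change of ideal. -/
lemma monomialQuot_propPieceMap {a b : Prop} {q : Fin n → ℤ} (ha : a → ∀ j, 0 ≤ q j)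
    (hb : b ↔ q ∈ standardDegrees J) (c : propPiece k a) :
    monomialQuot J (posPart q) (propPieceMap k a b c) = monomialQuot J (posPart q) c := by
  by_cases h : b
  · rw [propPieceMap_coe h]
  · rw [(propPieceMap k a b c).2 h, map_zero, eq_comm, monomialQuot_eq_zero_iff]
    by_cases h' : a
    · right
      by_contra hJ
      exact h (hb.2 ⟨ha h', hJ⟩)
    · exact Or.inl (c.2 h')

lemma monomialQuot_eq_monomial_smul {a : Prop} {q q' : Fin n → ℤ} (ha : a → ∀ j, 0 ≤ q j)
    (hq : ∀ j, q j ≤ q' j) (c : propPiece k a) :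
    monomialQuot J (posPart q') (c : k) =
      monomial (expDiff q q') (1 : k) • monomialQuot J (posPart q) (c : k) := by
  by_cases h : a
  · rw [monomial_smul_monomialQuot, expDiff_add_posPart (ha h) hq]
  · rw [c.2 h, map_zero, map_zero, smul_zero]

variable {Q : Type*} [Preorder Q] {v : DegreePoset n → Q} (hv : Monotone v) {A : Set Q}
  (hA : A.OrdConnected)

/-- The isomorphism of `S/J` with an interval module. -/
def intervalIsoQuotRing (h : ∀ q, v q ∈ A ↔ q ∈ standardDegrees J) :
    hv.functor ⋙ intervalModule k A hA ≅ quotRing J :=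
  NatIso.ofComponents (fun q => (LinearEquiv.ofBijective
    ((monomialQuot J (posPart q)).restrict (p := propPiece k (v q ∈ A)) (q := quotPiece J q)
      (monomialQuot_mem_quotPiece J (h q).1)) (by
        constructor
        · refine (injective_iff_map_eq_zero _).2 fun c hc => ?_
          by_cases hq : v q ∈ A
          · have hc' : monomialQuot J (posPart q) (c : k) = 0 := congrArg Subtype.val hc
            rw [monomialQuot_eq_zero_iff] at hc'
            exact Subtype.ext (hc'.resolve_right ((h q).1 hq).2)
          · exact Subtype.ext (c.2 hq)
        · rintro ⟨y, hy⟩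
          by_cases hq : ∀ j, 0 ≤ q j
          · rw [quotPiece_of_nonneg J hq] at hy
            obtain ⟨c, rfl⟩ := hy
            by_cases hq' : v q ∈ A
            · exact ⟨⟨c, fun h' => (h' hq').elim⟩, rfl⟩
            · have : monomial (posPart q) (1 : k) ∈ J := by
                by_contra hJ
                exact hq' ((h q).2 ⟨hq, hJ⟩)
              exact ⟨0, Subtype.ext (by
                rw [map_zero]
                exact ((monomialQuot_eq_zero_iff J).2 (Or.inr this)).symm)⟩
          · rw [quotPiece_of_not_nonneg J hq] at hy
            exact ⟨0, Subtype.ext (by rw [map_zero]; exact hy.symm)⟩)).toModuleIso) (by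
    intro q q' w
    have hw : ∀ j, q j ≤ q' j := w.le
    ext c
    apply Subtype.ext
    refine (monomialQuot_propPieceMap J (fun hq j => (((h q).1 hq).1 j).trans (hw j)) (h q')
      c).trans (monomialQuot_eq_monomial_smul J (fun hq => ((h q).1 hq).1) hw c))

lemma map_intervalModule_comp_intervalIsoQuotRing {J' : Ideal (MvPolynomial (Fin n) k)}
    {v' : DegreePoset n → Q} (hv' : Monotone v') (hJ : J' ≤ J)
    (h : ∀ q, v q ∈ A ↔ q ∈ standardDegrees J) (h' : ∀ q, v' q ∈ A ↔ q ∈ standardDegrees J')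
    (α : hv'.functor ⟶ hv.functor) :
    ((Functor.whiskeringLeft _ _ (ModuleCat.{u} k)).map α).app (intervalModule k A hA) ≫
      (intervalIsoQuotRing J hv hA h).hom =
    (intervalIsoQuotRing J' hv' hA h').hom ≫ quotMap hJ := by
  ext q c
  exact Subtype.ext (monomialQuot_propPieceMap J (fun hq => ((h' q).1 hq).1) (h q) c)

end Pieces

/-! ### Restriction along Galois connections -/

section GaloisConnection

open Functor

variable {k : Type u} [Field k] {Q P : Type} [Preorder Q] [Preorder P]
  {u : Q → P} {v : P → Q}

/-- The restriction of functors along a monotone map. -/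
abbrev restrict (k : Type u) [Field k] {v : P → Q} (hv : Monotone v) :
    (Q ⥤ ModuleCat.{u} k) ⥤ (P ⥤ ModuleCat.{u} k) :=
  (whiskeringLeft P Q (ModuleCat.{u} k)).obj hv.functor

instance (hv : Monotone v) : (restrict k hv).Additive where

/-- The adjunction between the restrictions given by a Galois connection. -/
def restrictAdjunction (k : Type u) [Field k] (gc : GaloisConnection u v) :
    restrict k gc.monotone_u ⊣ restrict k gc.monotone_l :=
  gc.adjunction.whiskerLeft (ModuleCat.{u} k)

instance : EnoughProjectives (Q ⥤ ModuleCat.{u} k) :=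
  have : Limits.HasColimitsOfSize.{0, 0} (ModuleCat.{u} k) :=
    Limits.hasColimitsOfSizeShrink.{0, 0, u, u} _
  enoughProjectives_functor

lemma preservesProjectiveObjects_restrict (gc : GaloisConnection u v) :
    (restrict k gc.monotone_u).PreservesProjectiveObjects :=
  preservesProjectiveObjects_of_adjunction_of_preservesEpimorphisms (restrictAdjunction k gc)

/-- The transpose of `f` under the adjunction has target the restriction of `Y` along `u`, which is
zero. -/
lemma restrict_hom_eq_zero (gc : GaloisConnection u v) {Y : P ⥤ ModuleCat.{u} k}
    (hY : ∀ s, Subsingleton (Y.obj (u s))) (X : Q ⥤ ModuleCat.{u} k)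
    (f : (restrict k gc.monotone_u).obj X ⟶ Y) : f = 0 := by
  apply ((restrictAdjunction k gc).homEquiv _ _).injective
  ext s x
  exact (hY s).elim _ _

lemma restrict_hom_postcomp_bijective (gc : GaloisConnection u v) {Y Y' : P ⥤ ModuleCat.{u} k}
    (g : Y ⟶ Y') (hg : ∀ s, IsIso (g.app (u s))) (X : Q ⥤ ModuleCat.{u} k) :
    Function.Bijective fun f : (restrict k gc.monotone_u).obj X ⟶ Y => f ≫ g := by
  let adj := restrictAdjunction k gc
  have hg' : IsIso ((restrict k gc.monotone_l).map g) :=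
    have (s : Q) : IsIso (((restrict k gc.monotone_l).map g).app s) := hg s
    NatIso.isIso_of_isIso_app _
  have e : (fun f : (restrict k gc.monotone_u).obj X ⟶ Y => f ≫ g) =
      (adj.homEquiv _ _).symm ∘ (fun f => f ≫ (restrict k gc.monotone_l).map g) ∘
        adj.homEquiv _ _ := by
    funext f
    apply (adj.homEquiv _ _).injective
    simp only [Function.comp_apply, Equiv.apply_symm_apply]
    exact adj.homEquiv_naturality_right _ _
  rw [e]
  exact (adj.homEquiv _ _).symm.bijective.comp
    (((asIso ((restrict k gc.monotone_l).map g)).homToEquiv).bijective.comp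
      (adj.homEquiv _ _).bijective)

variable {u' : Q → P} {v' : P → Q}

/-- The natural transformation given by an inequality of monotone maps. -/
def natTransOfLE (hu : Monotone u) (hu' : Monotone u') (h : ∀ s, u s ≤ u' s) :
    hu.functor ⟶ hu'.functor where
  app s := homOfLE (h s)

/-- Under the two adjunctions, precomposition with the transformation induced by `v' ≤ v` becomes
postcomposition with the restriction of `Y` along `u ≤ u'`, an isomorphism by `hY`. -/
lemma restrict_hom_precomp_bijective (gc : GaloisConnection u v) (gc' : GaloisConnection u' v')
    (hu : ∀ s, u s ≤ u' s) (hv : ∀ q, v' q ≤ v q) {Y : P ⥤ ModuleCat.{u} k}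
    (hY : ∀ s, IsIso (Y.map (homOfLE (hu s)))) (X : Q ⥤ ModuleCat.{u} k) :
    Function.Bijective fun f : (restrict k gc.monotone_u).obj X ⟶ Y =>
      ((whiskeringLeft P Q (ModuleCat.{u} k)).map
        (natTransOfLE gc'.monotone_u gc.monotone_u hv)).app X ≫ f := by
  let adj := restrictAdjunction k gc
  let adj' := restrictAdjunction k gc'
  let α : (restrict k gc.monotone_l).obj Y ⟶ (restrict k gc'.monotone_l).obj Y :=
    ((whiskeringLeft Q P (ModuleCat.{u} k)).map
      (natTransOfLE gc.monotone_l gc'.monotone_l hu)).app Y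
  have hα : IsIso α :=
    have (s : Q) : IsIso (α.app s) := hY s
    NatIso.isIso_of_isIso_app _
  have e : (fun f : (restrict k gc.monotone_u).obj X ⟶ Y =>
      ((whiskeringLeft P Q (ModuleCat.{u} k)).map
        (natTransOfLE gc'.monotone_u gc.monotone_u hv)).app X ≫ f) =
      (adj'.homEquiv _ _).symm ∘ (fun f => f ≫ α) ∘ adj.homEquiv _ _ := by
    funext f
    apply (adj'.homEquiv _ _).injective
    simp only [Function.comp_apply, Equiv.apply_symm_apply]
    apply NatTrans.ext
    funext s
    have h₁ : s ≤ v (u s) := gc.le_u_l s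
    have h₂ : s ≤ v' (u' s) := gc'.le_u_l s
    let φ (q : P) : X.obj (v q) ⟶ Y.obj q := f.app q
    have hφ {q q' : P} (h : q ≤ q') :
        X.map (homOfLE (gc.monotone_u h)) ≫ φ q' = φ q ≫ Y.map (homOfLE h) :=
      f.naturality (homOfLE h)
    change X.map (homOfLE h₂) ≫ X.map (homOfLE (hv (u' s))) ≫ φ (u' s) =
      (X.map (homOfLE h₁) ≫ φ (u s)) ≫ Y.map (homOfLE (hu s))
    rw [Category.assoc, ← hφ, ← X.map_comp_assoc, ← X.map_comp_assoc]
    rfl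
  rw [e]
  exact (adj'.homEquiv _ _).symm.bijective.comp
    (((asIso α).homToEquiv).bijective.comp (adj.homEquiv _ _).bijective)

end GaloisConnection

/-! ### Bracket powers -/

section BracketPower

variable {k : Type u} [Field k] {n : ℕ}

/-- The ideal generated by the square-free monomials with supports in `F`. -/
def squarefreeIdeal (k : Type u) [Field k] (F : Set (Finset (Fin n))) :
    Ideal (MvPolynomial (Fin n) k) :=
  Ideal.span ((fun J => ∏ j ∈ J, (X j : MvPolynomial (Fin n) k)) '' F)

lemma monomial_mem_span_iff {A : Set (Fin n →₀ ℕ)} {a : Fin n →₀ ℕ} :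
    monomial a (1 : k) ∈ Ideal.span ((fun a => monomial a (1 : k)) '' A) ↔ ∃ b ∈ A, b ≤ a := by
  classical
  rw [mem_ideal_span_monomial_image, support_monomial, if_neg one_ne_zero]
  simp

lemma monomial_mem_squarefreeIdeal_iff {F : Set (Finset (Fin n))} {a : Fin n →₀ ℕ} :
    monomial a (1 : k) ∈ squarefreeIdeal k F ↔ ∃ J ∈ F, ∀ j ∈ J, 1 ≤ a j := by
  classical
  have e : squarefreeIdeal k F = Ideal.span ((fun a => monomial a (1 : k)) ''
      ((fun J : Finset (Fin n) => ∑ j ∈ J, Finsupp.single j 1) '' F)) := by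
    rw [squarefreeIdeal, Set.image_image]
    congr 1
    refine Set.image_congr fun J _ => ?_
    rw [monomial_sum_one]
    rfl
  rw [e, monomial_mem_span_iff, Set.exists_mem_image]
  refine exists_congr fun J => and_congr_right fun _ => ?_
  rw [Finsupp.le_def]
  simp only [Finsupp.coe_finsetSum, Finset.sum_apply, Finsupp.single_apply,
    Finset.sum_ite_eq']
  refine forall_congr' fun j => ?_
  split_ifs with h <;> simp [h]

lemma monomial_mem_bracketPower_iff {F : Set (Finset (Fin n))} {l : ℕ} {a : Fin n →₀ ℕ} :
    monomial a (1 : k) ∈ bracketPower (squarefreeIdeal k F) l ↔ ∃ J ∈ F, ∀ j ∈ J, l ≤ a j := by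
  classical
  have e : bracketPower (squarefreeIdeal k F) l = Ideal.span ((fun a => monomial a (1 : k)) ''
      {b | ∃ a : Fin n →₀ ℕ, monomial a (1 : k) ∈ squarefreeIdeal k F ∧ b = l • a}) := by
    unfold bracketPower
    congr 1
    ext f
    constructor
    · rintro ⟨a, ha, rfl⟩
      exact ⟨l • a, ⟨a, ha, rfl⟩, by simp [monomial_pow]⟩
    · rintro ⟨_, ⟨a, ha, rfl⟩, rfl⟩
      exact ⟨a, ha, by simp [monomial_pow]⟩
  rw [e, monomial_mem_span_iff]
  constructor
  · rintro ⟨_, ⟨b, hb, rfl⟩, hba⟩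
    obtain ⟨J, hJ, hb⟩ := monomial_mem_squarefreeIdeal_iff.1 hb
    refine ⟨J, hJ, fun j hj => (Nat.le_mul_of_pos_right l (hb j hj)).trans (hba j)⟩
  · rintro ⟨J, hJ, ha⟩
    -- The square-free monomial with support `J` is the witness: its `l`-th power divides `x^a`.
    refine ⟨_, ⟨Finsupp.indicator J fun _ _ => 1,
      monomial_mem_squarefreeIdeal_iff.2 ⟨J, hJ, fun j hj => ?_⟩, rfl⟩, fun j => ?_⟩
    · simp [Finsupp.indicator_apply, hj]
    · by_cases hj : j ∈ J
      · simpa [Finsupp.indicator_apply, hj] using ha j hj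
      · simp [Finsupp.indicator_apply, hj]

lemma bracketPower_anti (B : Ideal (MvPolynomial (Fin n) k)) {l l' : ℕ} (h : l ≤ l') :
    bracketPower B l' ≤ bracketPower B l := by
  refine Ideal.span_le.2 ?_
  rintro _ ⟨a, ha, rfl⟩
  rw [← Nat.sub_add_cancel h, pow_add]
  exact Ideal.mul_mem_left _ _ (Ideal.subset_span ⟨a, ha, rfl⟩)

end BracketPower

/-! ### Collapsing degrees -/

section Collapse

variable {n : ℕ}

/-- The poset of the degrees with coordinates at most `1`. -/
abbrev Cube (n : ℕ) : Type := {s : DegreePoset n // ∀ j, s j ≤ 1}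

/-- The map `ℤⁿ → Cube n` whose coordinates send `[l, ∞)` to `1` and `[0, l)` to `0`, and are
translations, truncated to stay negative, on the negative integers. -/
def collapse (l : ℕ) (t : Fin n → ℕ) (q : DegreePoset n) : Cube n :=
  ⟨fun j => if q j < 0 then min (-1) (q j + t j) else if q j < l then 0 else 1, fun j => by
    dsimp only
    split_ifs <;> omega⟩

/-- The left adjoint of `collapse l t`. -/
def stretch (l : ℕ) (t : Fin n → ℕ) (s : Cube n) : DegreePoset n :=
  fun j => if s.1 j < 0 then s.1 j - t j else if s.1 j = 0 then 0 else l

lemma stretch_of_neg {l : ℕ} {t : Fin n → ℕ} {s : Cube n} {j : Fin n} (h : s.1 j < 0) :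
    stretch l t s j = s.1 j - t j := if_pos h

lemma stretch_of_eq_zero {l : ℕ} {t : Fin n → ℕ} {s : Cube n} {j : Fin n} (h : s.1 j = 0) :
    stretch l t s j = 0 := by simp [stretch, h]

lemma stretch_of_pos {l : ℕ} {t : Fin n → ℕ} {s : Cube n} {j : Fin n} (h : 0 < s.1 j) :
    stretch l t s j = l := by simp [stretch, h.not_gt, h.ne']

lemma stretch_cases (l : ℕ) (t : Fin n → ℕ) (s : Cube n) (j : Fin n) :
    (s.1 j < 0 ∧ stretch l t s j = s.1 j - t j) ∨ (s.1 j = 0 ∧ stretch l t s j = 0) ∨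
      (0 < s.1 j ∧ stretch l t s j = l) := by
  rcases lt_trichotomy (s.1 j) 0 with h | h | h
  · exact Or.inl ⟨h, stretch_of_neg h⟩
  · exact Or.inr (Or.inl ⟨h, stretch_of_eq_zero h⟩)
  · exact Or.inr (Or.inr ⟨h, stretch_of_pos h⟩)

lemma collapse_of_neg {l : ℕ} {t : Fin n → ℕ} {q : DegreePoset n} {j : Fin n} (h : q j < 0) :
    (collapse l t q).1 j = min (-1) (q j + t j) := if_pos h

lemma collapse_of_lt {l : ℕ} {t : Fin n → ℕ} {q : DegreePoset n} {j : Fin n} (h : 0 ≤ q j)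
    (h' : q j < l) : (collapse l t q).1 j = 0 := by simp [collapse, h.not_gt, h']

lemma collapse_of_le {l : ℕ} {t : Fin n → ℕ} {q : DegreePoset n} {j : Fin n} (h : (l : ℤ) ≤ q j) :
    (collapse l t q).1 j = 1 := by
  have : 0 ≤ q j := by omega
  simp [collapse, h.not_gt, this.not_gt]

/-- The adjunction is what forces `Cube n` to be unbounded below: were all negative integers sent to
one value, they would need a least element for a left adjoint to exist. -/
lemma gc_stretch_collapse (l : ℕ) (t : Fin n → ℕ) :
    GaloisConnection (stretch l t) (collapse l t) := by
  intro s q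
  refine forall_congr' fun j => ?_
  change stretch l t s j ≤ q j ↔ s.1 j ≤ (collapse l t q).1 j
  have := s.2 j
  rcases lt_trichotomy (s.1 j) 0 with h | h | h
  · rw [stretch_of_neg h]
    by_cases hq : q j < 0
    · rw [collapse_of_neg hq]; omega
    · by_cases hq' : q j < l
      · rw [collapse_of_lt (by omega) hq']; omega
      · rw [collapse_of_le (by omega)]; omega
  · rw [stretch_of_eq_zero h]
    by_cases hq : q j < 0
    · rw [collapse_of_neg hq]; omega
    · by_cases hq' : q j < l
      · rw [collapse_of_lt (by omega) hq']; omega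
      · rw [collapse_of_le (by omega)]; omega
  · rw [stretch_of_pos h]
    by_cases hq : q j < 0
    · rw [collapse_of_neg hq]; omega
    · by_cases hq' : q j < l
      · rw [collapse_of_lt (by omega) hq']; omega
      · rw [collapse_of_le (by omega)]; omega

lemma stretch_le_stretch {l l' : ℕ} (h : l ≤ l') (t : Fin n → ℕ) (s : Cube n) :
    stretch l t s ≤ stretch l' t s := by
  intro j
  dsimp only [stretch]
  split_ifs <;> omega

lemma collapse_le_collapse {l l' : ℕ} (h : l ≤ l') (t : Fin n → ℕ) (q : DegreePoset n) :
    collapse l' t q ≤ collapse l t q :=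
  (gc_stretch_collapse l t).le_u
    ((stretch_le_stretch h t _).trans ((gc_stretch_collapse l' t).l_u_le q))

/-- The points of the cube corresponding to the monomials that are not in the ideal generated by
the square-free monomials with supports in `F`. -/
def standardCube (F : Set (Finset (Fin n))) : Set (Cube n) :=
  {s | (∀ j, 0 ≤ s.1 j) ∧ ¬ ∃ J ∈ F, ∀ j ∈ J, 1 ≤ s.1 j}

lemma standardCube_ordConnected (F : Set (Finset (Fin n))) : (standardCube F).OrdConnected where
  out' s hs s' hs' r hr := by
    refine ⟨fun j => (hs.1 j).trans (hr.1 j), ?_⟩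
    rintro ⟨J, hJ, h⟩
    exact hs'.2 ⟨J, hJ, fun j hj => (h j hj).trans (hr.2 j)⟩

/-- A coordinate of `collapse l t q` reaches `1` exactly when `q j ≥ l`, so `l`-th powers become
first powers. The shift `t` moves only negative coordinates within the negatives. -/
lemma collapse_mem_standardCube_iff (k : Type u) [Field k] {F : Set (Finset (Fin n))} (l : ℕ)
    (t : Fin n → ℕ) (q : DegreePoset n) :
    collapse l t q ∈ standardCube F ↔
      q ∈ standardDegrees (bracketPower (squarefreeIdeal k F) l) := by
  have h0 (j : Fin n) : 0 ≤ (collapse l t q).1 j ↔ 0 ≤ q j := by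
    dsimp only [collapse]
    split_ifs <;> omega
  refine (and_congr_left' (forall_congr' h0)).trans (and_congr_right fun hq => not_congr ?_)
  rw [monomial_mem_bracketPower_iff]
  refine exists_congr fun J => and_congr_right fun _ => forall₂_congr fun j _ => ?_
  have := hq j
  change 1 ≤ (collapse l t q).1 j ↔ l ≤ (q j).toNat
  by_cases h : q j < l
  · rw [collapse_of_lt this h]
    omega
  · rw [collapse_of_le (by omega)]
    omega

end Collapse

/-! ### The extensions of `S/B^[l]` by `S` -/

section Ext

open Functor Abelian

variable {k : Type u} [Field k] {n : ℕ} {F : Set (Finset (Fin n))}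

/-- The isomorphism of `S/B^[l]` with the pullback of the interval module of the cube. -/
def collapseIsoQuotRing (k : Type u) [Field k] (F : Set (Finset (Fin n))) (l : ℕ)
    (t : Fin n → ℕ) :
    (restrict k (gc_stretch_collapse l t).monotone_u).obj
      (intervalModule k (standardCube F) (standardCube_ordConnected F)) ≅
    quotRing (bracketPower (squarefreeIdeal k F) l) :=
  intervalIsoQuotRing _ _ _ (collapse_mem_standardCube_iff k l t)

lemma ext_precomp_iso_bijective {C : Type*} [Category* C] [Abelian C] [HasExt.{w} C] {X X' : C}
    (e : X ≅ X') (Y : C) (i : ℕ) :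
    Function.Bijective fun x : Ext X' Y i => (Ext.mk₀ e.hom).comp x (zero_add i) := by
  refine Function.bijective_iff_has_inverse.2
    ⟨fun x => (Ext.mk₀ e.inv).comp x (zero_add i), fun x => ?_, fun x => ?_⟩ <;>
  simp only [Ext.mk₀_comp_mk₀_assoc, e.inv_hom_id, e.hom_inv_id, Ext.mk₀_id_comp]

/-- Coordinates of `stretch l 0 s` never exceed `l`, so the `j`-th coordinate of `p + stretch l 0 s`
is always negative, and `S` vanishes there. -/
theorem extPiece_subsingleton {l : ℕ} {p : Fin n → ℤ} {j : Fin n} (hj : p j < -l) (i : ℕ) :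
    Subsingleton (extPiece (bracketPower (squarefreeIdeal k F) l) i p) := by
  have gc := gc_stretch_collapse l (0 : Fin n → ℕ)
  have := preservesProjectiveObjects_restrict (k := k) gc
  have h := subsingleton_ext_of_hom (restrict k gc.monotone_u) (Y := twist p (polyRing k n))
    (restrict_hom_eq_zero gc fun s => polyRing_obj_subsingleton fun h => by
      have : 0 ≤ p j + stretch l 0 s j := h j
      rcases stretch_cases l 0 s j with h | h | h <;> omega) i
      (intervalModule k (standardCube F) (standardCube_ordConnected F))
  exact (ext_precomp_iso_bijective (collapseIsoQuotRing k F l 0) _ i).1.subsingleton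

/-- The points `stretch l 0 s` and `stretch l' 0 s` differ only where `s` is positive; there the
coordinates of degree `p + l` and `p + l'` are both nonnegative, so the pieces of `S` agree. -/
theorem extTransition_bijective {l l' : ℕ} (hl : l ≤ l') {p : Fin n → ℤ} (hp : ∀ j, -l ≤ p j)
    (i : ℕ) : Function.Bijective
      (extTransition (bracketPower_anti (squarefreeIdeal k F) hl) i p) := by
  have gc := gc_stretch_collapse l (0 : Fin n → ℕ)
  have gc' := gc_stretch_collapse l' (0 : Fin n → ℕ)
  have := preservesProjectiveObjects_restrict (k := k) gc
  have := preservesProjectiveObjects_restrict (k := k) gc'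
  let Y := twist p (polyRing k n)
  let R := intervalModule k (standardCube F) (standardCube_ordConnected F)
  let τ : restrict k gc'.monotone_u ⟶ restrict k gc.monotone_u :=
    (whiskeringLeft _ _ (ModuleCat.{u} k)).map
      (natTransOfLE gc'.monotone_u gc.monotone_u (collapse_le_collapse hl 0))
  have h := bijective_ext_precomp_of_hom τ (Y := Y)
    (restrict_hom_precomp_bijective gc gc' (stretch_le_stretch hl 0)
      (collapse_le_collapse hl 0) fun s => by
        rw [ConcreteCategory.isIso_iff_bijective]
        refine polyRing_map_bijective ((translate_monotone p).functor.map
          (homOfLE (stretch_le_stretch hl 0 s))) fun h j => ?_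
        have h₁ : 0 ≤ p j + stretch l' 0 s j := h j
        have h₂ := hp j
        change 0 ≤ p j + stretch l 0 s j
        rcases stretch_cases l 0 s j with h | h | h <;>
          rcases stretch_cases l' 0 s j with h' | h' | h' <;> omega) i R
  have sq : τ.app R ≫ (collapseIsoQuotRing k F l 0).hom =
      (collapseIsoQuotRing k F l' 0).hom ≫ quotMap (bracketPower_anti (squarefreeIdeal k F) hl) :=
    map_intervalModule_comp_intervalIsoQuotRing ..
  have h₁ := ext_precomp_iso_bijective (collapseIsoQuotRing k F l 0) Y i
  have h₂ := ext_precomp_iso_bijective (collapseIsoQuotRing k F l' 0) Y i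
  refine (h₂.of_comp_iff' _).1 ?_
  convert! h.comp h₁ using 1
  funext x
  refine (Ext.mk₀_comp_mk₀_assoc _ _ x).trans (Eq.trans ?_ (Ext.mk₀_comp_mk₀_assoc _ _ x).symm)
  exact congrArg (fun f => (Ext.mk₀ f).comp x (zero_add i)) sq.symm

/-- The multiplication by `x^(p' - p)`, from `N(p)` to `N(p')`. -/
def twistMap {p p' : Fin n → ℤ} (h : ∀ j, p j ≤ p' j) (N : GrMod k n) : twist p N ⟶ twist p' N :=
  whiskerRight (natTransOfLE (translate_monotone p) (translate_monotone p')
    fun q j => add_le_add_left (h j) (q j)) N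

theorem nontrivial_extPiece_iff {l : ℕ} {p p' : Fin n → ℤ} (h : ∀ j, p j ≤ p' j)
    (hs : negSupport p = negSupport p') (hp : ∀ j, -l ≤ p j) (i : ℕ) :
    Nontrivial (extPiece (bracketPower (squarefreeIdeal k F) l) i p) ↔
      Nontrivial (extPiece (bracketPower (squarefreeIdeal k F) l) i p') := by
  -- This shift makes `p' j + stretch l t s j` negative whenever `s.1 j < 0`; with `t = 0` a
  -- positive `p' j` could make it nonnegative while the same sum for `p` is negative.
  let t : Fin n → ℕ := fun j => (p' j).toNat
  have gc := gc_stretch_collapse l t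
  have := preservesProjectiveObjects_restrict (k := k) gc
  let R := intervalModule k (standardCube F) (standardCube_ordConnected F)
  have b := bijective_ext_postcomp_of_hom (restrict k gc.monotone_u)
    (twistMap h (polyRing k n)) (restrict_hom_postcomp_bijective gc _ fun s => by
      rw [ConcreteCategory.isIso_iff_bijective]
      refine polyRing_map_bijective ((natTransOfLE (translate_monotone p) (translate_monotone p')
        fun q j => add_le_add_left (h j) (q j)).app (stretch l t s)) fun h' j => ?_
      have h₁ : 0 ≤ p' j + stretch l t s j := h' j
      change 0 ≤ p j + stretch l t s j
      have h₂ := hp j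
      have h₃ := h j
      have h₄ : p j < 0 ↔ p' j < 0 := by
        simpa [negSupport] using congrArg (j ∈ ·) hs
      have h₅ : (t j : ℤ) = max (p' j) 0 := Int.toNat_eq_max _
      rcases stretch_cases l t s j with h | h | h <;> omega) i R
  have e₁ := ext_precomp_iso_bijective (collapseIsoQuotRing k F l t) (twist p (polyRing k n)) i
  have e₂ := ext_precomp_iso_bijective (collapseIsoQuotRing k F l t) (twist p' (polyRing k n)) i
  rw [(Equiv.ofBijective _ e₁).nontrivial_congr, (Equiv.ofBijective _ e₂).nontrivial_congr]
  exact (Equiv.ofBijective _ b).nontrivial_congr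

end Ext

/-! ### Local cohomology as a direct limit along the bracket powers -/

section DirectLimit

open Abelian Module

variable {k : Type u} [Field k] {n : ℕ}

lemma extTransition_refl (J : Ideal (MvPolynomial (Fin n) k)) (i : ℕ) (p : Fin n → ℤ)
    (x : extPiece J i p) : extTransition le_rfl i p x = x := by
  have e : quotMap (le_refl J) = 𝟙 (quotRing J) := by
    ext q ⟨_, y, hy, rfl⟩
    rfl
  change (Ext.mk₀ (quotMap (le_refl J))).comp x (zero_add i) = x
  rw [e, Ext.mk₀_id_comp]

lemma extTransition_trans {J J' J'' : Ideal (MvPolynomial (Fin n) k)} (h : J ≤ J') (h' : J' ≤ J'')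
    (i : ℕ) (p : Fin n → ℤ) (x : extPiece J'' i p) :
    extTransition h i p (extTransition h' i p x) = extTransition (h.trans h') i p x := by
  have e : quotMap h ≫ quotMap h' = quotMap (h.trans h') := by
    ext q ⟨_, y, hy, rfl⟩
    rfl
  change (Ext.mk₀ (quotMap h)).comp ((Ext.mk₀ (quotMap h')).comp x (zero_add i)) (zero_add i) =
    (Ext.mk₀ (quotMap (h.trans h'))).comp x (zero_add i)
  rw [Ext.mk₀_comp_mk₀_assoc, e]

/-- As `B` is finitely generated, some `B^m` lies in `J`, and `l`-th powers of elements of `B` lie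
in `B^m` once `l ≥ m`. This is cofinality of the bracket powers. -/
lemma exists_bracketPower_le {B J : Ideal (MvPolynomial (Fin n) k)} (h : B ≤ J.radical) :
    ∃ l₀, ∀ l, l₀ ≤ l → bracketPower B l ≤ J := by
  obtain ⟨m, hm⟩ := Ideal.exists_pow_le_of_le_radical_of_fg h (IsNoetherian.noetherian B)
  refine ⟨m, fun l hl => Ideal.span_le.2 ?_⟩
  rintro _ ⟨a, ha, rfl⟩
  exact hm (Ideal.pow_le_pow_right hl (Ideal.pow_mem_pow ha l))

variable {B : Ideal (MvPolynomial (Fin n) k)}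

/-- The bracket powers of `B`, as indices of the direct system defining local cohomology. -/
def bracketIndex (hB : IsSquarefreeMonomialIdeal B) (l : ℕ) : (SupportIdeal B)ᵒᵈ :=
  OrderDual.toDual
    ⟨bracketPower B l, bracketPower_isMonomialIdeal B l, hB.le_radical_bracketPower l⟩

lemma exists_le_bracketIndex (hB : IsSquarefreeMonomialIdeal B) (J : (SupportIdeal B)ᵒᵈ) :
    ∃ l₀, ∀ l, l₀ ≤ l → J ≤ bracketIndex hB l :=
  exists_bracketPower_le (OrderDual.ofDual J).2.2

lemma isDirectedOrder_supportIdeal (hB : IsSquarefreeMonomialIdeal B) :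
    IsDirectedOrder (SupportIdeal B)ᵒᵈ where
  directed J J' := by
    obtain ⟨l, hl⟩ := exists_le_bracketIndex hB J
    obtain ⟨l', hl'⟩ := exists_le_bracketIndex hB J'
    exact ⟨_, hl _ (le_max_left l l'), hl' _ (le_max_right l l')⟩

/-- The direct system defining local cohomology. -/
def extSystem (B : Ideal (MvPolynomial (Fin n) k)) (i : ℕ) (p : Fin n → ℤ)
    (J J' : (SupportIdeal B)ᵒᵈ) (h : J ≤ J') :
    extPiece (OrderDual.ofDual J).1 i p →ₗ[k] extPiece (OrderDual.ofDual J').1 i p :=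
  extTransition (J := (OrderDual.ofDual J').1) (J' := (OrderDual.ofDual J).1) h i p

instance (i : ℕ) (p : Fin n → ℤ) : DirectedSystem
    (fun J : (SupportIdeal B)ᵒᵈ => extPiece (OrderDual.ofDual J).1 i p)
    (extSystem B i p · · ·) where
  map_self _ := extTransition_refl _ i p
  map_map _ _ _ h h' := extTransition_trans h' h i p

open Classical in
theorem toLC_bijective (hB : IsSquarefreeMonomialIdeal B) {l : ℕ} {p : Fin n → ℤ}
    (hp : ∀ j, -l ≤ p j) (i : ℕ) : Function.Bijective (toLC hB l i p) := by
  have := isDirectedOrder_supportIdeal hB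
  have hne : Nonempty (SupportIdeal B)ᵒᵈ := ⟨bracketIndex hB l⟩
  let f := extSystem B i p
  let G := fun J : (SupportIdeal B)ᵒᵈ => extPiece (OrderDual.ofDual J).1 i p
  have hle {l l' : ℕ} (h : l ≤ l') : bracketIndex hB l ≤ bracketIndex hB l' :=
    bracketPower_anti B h
  have hbij {l' : ℕ} (h : l ≤ l') : Function.Bijective (f _ _ (hle h)) := by
    obtain ⟨F, hF⟩ := id hB
    subst hF
    exact extTransition_bijective h hp i
  constructor
  · refine (injective_iff_map_eq_zero _).2 fun x hx => ?_
    -- An element that dies in the limit dies at some `J`, hence at a later bracket power, where the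
    -- transition map is injective.
    obtain ⟨J, hJ, hx⟩ := DirectLimit.of.zero_exact (f := f) (i := bracketIndex hB l) hx
    obtain ⟨l₀, hl₀⟩ := exists_le_bracketIndex hB J
    have h := hl₀ _ (le_max_right l l₀)
    apply (hbij (le_max_left l l₀)).1
    exact (extTransition_trans h hJ i p x).symm.trans
      (((congrArg (f _ _ h) hx).trans (map_zero _)).trans (map_zero _).symm)
  · intro z
    obtain ⟨J, x, rfl⟩ := DirectLimit.exists_of (f := f) z
    obtain ⟨l₀, hl₀⟩ := exists_le_bracketIndex hB J
    have h := hl₀ _ (le_max_right l l₀)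
    obtain ⟨y, hy⟩ := (hbij (le_max_left l l₀)).2 (f _ _ h x)
    refine ⟨y, ?_⟩
    have h₁ := DirectLimit.of_f (R := k) (f := f) (hij := hle (le_max_left l l₀)) (x := y)
    have h₂ := DirectLimit.of_f (R := k) (f := f) (hij := h) (x := x)
    rw [hy] at h₁
    exact h₁.symm.trans h₂

lemma bracketPower_extPiece_subsingleton (hB : IsSquarefreeMonomialIdeal B) {l : ℕ}
    {p : Fin n → ℤ} {j : Fin n} (hj : p j < -l) (i : ℕ) :
    Subsingleton (extPiece (bracketPower B l) i p) := by
  obtain ⟨F, rfl⟩ := hB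
  exact extPiece_subsingleton hj i

theorem toLC_bijective_iff (hB : IsSquarefreeMonomialIdeal B) (l i : ℕ) (p : Fin n → ℤ) :
    Function.Bijective (toLC hB l i p) ↔ (Nontrivial (lcPiece B i p) → ∀ j, -l ≤ p j) := by
  constructor
  · intro h hn j
    by_contra! hj
    have := bracketPower_extPiece_subsingleton hB hj i
    exact not_subsingleton _ h.2.subsingleton
  · intro h
    by_cases hp : ∀ j, -l ≤ p j
    · exact toLC_bijective hB hp i
    · have h₁ : Subsingleton (lcPiece B i p) := not_nontrivial_iff_subsingleton.1 (mt h hp)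
      push Not at hp
      obtain ⟨j, hj⟩ := hp
      have := bracketPower_extPiece_subsingleton hB hj i
      exact ⟨Function.injective_of_subsingleton _, fun z => ⟨0, h₁.elim _ _⟩⟩

lemma nontrivial_lcPiece_iff_of_le (hB : IsSquarefreeMonomialIdeal B) {p p' : Fin n → ℤ}
    (h : ∀ j, p j ≤ p' j) (hs : negSupport p = negSupport p') (i : ℕ) :
    Nontrivial (lcPiece B i p) ↔ Nontrivial (lcPiece B i p') := by
  -- Large enough that both local cohomology pieces are computed by `Ext` from the same `S/B^[l]`.
  let l := Finset.univ.sup fun j => (-p j).toNat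
  have hp (j : Fin n) : -l ≤ p j := by
    have : (-p j).toNat ≤ l := Finset.le_sup (f := fun j => (-p j).toNat) (Finset.mem_univ j)
    omega
  have hp' (j : Fin n) : -l ≤ p' j := (hp j).trans (h j)
  rw [← (Equiv.ofBijective _ (toLC_bijective hB hp i)).nontrivial_congr,
    ← (Equiv.ofBijective _ (toLC_bijective hB hp' i)).nontrivial_congr]
  obtain ⟨F, hF⟩ := id hB
  subst hF
  exact nontrivial_extPiece_iff h hs hp i

/-- Both degrees are compared with their supremum, which has the same negative support. -/
lemma nontrivial_lcPiece_iff (hB : IsSquarefreeMonomialIdeal B) {p p' : Fin n → ℤ}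
    (hs : negSupport p = negSupport p') (i : ℕ) :
    Nontrivial (lcPiece B i p) ↔ Nontrivial (lcPiece B i p') := by
  have hs' : negSupport (p ⊔ p') = negSupport p := by
    ext j
    have : p j < 0 ↔ p' j < 0 := by simpa [negSupport] using congrArg (j ∈ ·) hs
    simp [negSupport, this]
  exact (nontrivial_lcPiece_iff_of_le hB (fun j => le_sup_left (a := p j)) hs'.symm i).trans
    (nontrivial_lcPiece_iff_of_le hB (fun j => le_sup_right (a := p j)) (hs.symm.trans hs'.symm)
      i).symm

lemma negSupport_mem_sigmaSet_iff (hB : IsSquarefreeMonomialIdeal B) (i : ℕ) (p : Fin n → ℤ) :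
    negSupport p ∈ sigmaSet B i ↔ Nontrivial (lcPiece B i p) :=
  ⟨fun h => h p rfl, fun h _ hp => (nontrivial_lcPiece_iff hB hp i).2 h⟩

variable {D : Type*} [AddCommGroup D] (φ : (Fin n → ℤ) →+ D)

theorem toLCCoarse_bijective_iff (hB : IsSquarefreeMonomialIdeal B) (l i : ℕ) (δ : D) :
    Function.Bijective (toLCCoarse φ hB l i δ) ↔
      ∀ q, φ q = δ → negSupport q ∈ sigmaSet B i → ∀ j, -l ≤ q j := by
  have h : Function.Bijective (toLCCoarse φ hB l i δ) ↔
      ∀ q : {q // φ q = δ}, Function.Bijective (toLC hB l i q.1) := by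
    rw [Function.Bijective, toLCCoarse, DirectSum.lmap_injective, DirectSum.lmap_surjective,
      ← forall_and]
    rfl
  rw [h, Subtype.forall]
  refine forall₂_congr fun q _ => ?_
  rw [toLC_bijective_iff, negSupport_mem_sigmaSet_iff hB]

/-- One nonzero vector from each nonzero summand gives a linearly independent family. -/
lemma finite_nontrivial_of_finite_directSum {ι : Type*} (N : ι → Type*)
    [∀ j, AddCommGroup (N j)] [∀ j, Module k (N j)] [Module.Finite k (DirectSum ι N)] :
    {j | Nontrivial (N j)}.Finite := by
  classical
  have h (j : {j | Nontrivial (N j)}) : ∃ x : N j, x ≠ 0 :=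
    have : Nontrivial (N j) := j.2
    exists_ne 0
  choose x hx using h
  have hli : LinearIndependent k
      fun j : {j | Nontrivial (N j)} => DirectSum.lof k ι N j (x j) := by
    rw [linearIndependent_iff']
    intro s g hg j hj
    have := congrArg (DirectSum.component k ι N j) hg
    rw [map_sum, map_zero, Finset.sum_eq_single_of_mem j hj] at this
    · rw [map_smul, DirectSum.component.lof_self] at this
      exact (smul_eq_zero.1 this).resolve_right (hx j)
    · intro j' _ hj'
      rw [map_smul, DirectSum.component.of, dif_neg (fun e => hj' (Subtype.ext e)), smul_zero]
  exact Set.finite_coe_iff.1 hli.finite_of_isNoetherian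

end DirectLimit

/-! ### Lattice slices -/

section Slices

variable {n : ℕ} (M : AddSubgroup (Fin n → ℤ)) (p : Fin n → ℤ) (I : Finset (Fin n))

lemma mem_slice_iff {q : Fin n → ℤ} :
    q ∈ slice M p I ↔ q - p ∈ M ∧ ∀ j, (j ∈ I → q j ≤ -1) ∧ (j ∉ I → 0 ≤ q j) := by
  refine and_congr_right fun _ => forall_congr' fun j => ?_
  by_cases hj : j ∈ I <;> simp [corner, hj]
  omega

lemma mem_slice_iff_negSupport {q : Fin n → ℤ} :
    q ∈ slice M p I ↔ q - p ∈ M ∧ negSupport q = I := by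
  rw [mem_slice_iff]
  refine and_congr_right fun _ => ?_
  rw [Finset.ext_iff]
  refine forall_congr' fun j => ?_
  by_cases hj : j ∈ I <;> simp [negSupport, hj]
  omega

lemma toReal_mem_realSlice_iff {q : Fin n → ℤ} (hq : q - p ∈ M) :
    toReal q ∈ realSlice M p I ↔ q ∈ slice M p I := by
  have h : toReal q - toReal p ∈ Submodule.span ℝ (toReal '' (M : Set (Fin n → ℤ))) :=
    Submodule.subset_span ⟨q - p, hq, by ext; simp [toReal]⟩
  rw [mem_slice_iff]
  constructor
  · rintro ⟨-, h⟩
    refine ⟨hq, fun j => ⟨fun hj => ?_, fun hj => ?_⟩⟩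
    · have := (h j).1 hj
      simp only [toReal] at this
      exact_mod_cast this
    · have := (h j).2 hj
      simp only [toReal] at this
      exact_mod_cast this
  · rintro ⟨-, h'⟩
    refine ⟨h, fun j => ⟨fun hj => ?_, fun hj => ?_⟩⟩
    · have := (h' j).1 hj
      simp only [toReal]
      exact_mod_cast this
    · have := (h' j).2 hj
      simp only [toReal]
      exact_mod_cast this

lemma isPolyhedron_of_finite {ι : Type*} [Finite ι] (f : ι → ((Fin n → ℝ) →ₗ[ℝ] ℝ) × ℝ) :
    IsPolyhedron {x | ∀ i, (f i).1 x ≤ (f i).2} :=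
  ⟨(Set.finite_range f).toFinset, by ext x; simp⟩

theorem realSlice_isPolyhedron : IsPolyhedron (realSlice M p I) := by
  classical
  let V := Submodule.span ℝ (toReal '' (M : Set (Fin n → ℤ)))
  let b := Module.finBasis ℝ ((Fin n → ℝ) ⧸ V)
  let c := fun i => b.coord i ∘ₗ V.mkQ
  have hV (y : Fin n → ℝ) : y ∈ V ↔ ∀ i, c i y = 0 := by
    refine (Submodule.Quotient.mk_eq_zero V).symm.trans ?_
    exact b.forall_coord_eq_zero_iff.symm
  -- Membership in `p + V` is the vanishing of the coordinates modulo `V`, each equation being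
  -- written as two inequalities.
  convert isPolyhedron_of_finite (Sum.elim (Sum.elim (fun i => (c i, c i (toReal p)))
      fun i => (-c i, -c i (toReal p)))
      fun j => if j ∈ I then (LinearMap.proj j, -1) else (-LinearMap.proj j, 0)) using 1
  ext x
  simp only [Set.mem_ofPred_eq, Sum.forall, Sum.elim_inl, Sum.elim_inr]
  refine and_congr ?_ (forall_congr' fun j => ?_)
  · refine (hV _).trans ?_
    simp only [map_sub, sub_nonpos, sub_nonneg, le_antisymm_iff, forall_and, LinearMap.neg_apply,
      neg_le_neg_iff]
  · by_cases hj : j ∈ I <;> simp [hj]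

/-- The points of the affine span of a lattice are at bounded distance from the lattice. -/
lemma exists_near_lattice : ∃ C : ℕ, ∀ y ∈ Submodule.span ℝ (toReal '' (M : Set (Fin n → ℤ))),
    ∃ m ∈ M, ∀ j, |y j - m j| ≤ C := by
  obtain ⟨f, hf, hspan, -⟩ := Submodule.exists_fun_fin_finrank_span_eq ℝ (toReal '' (M : Set (Fin n → ℤ)))
  choose m hm hmf using hf
  obtain ⟨C, hC⟩ := exists_nat_ge (∑ j, ∑ i, |f i j|)
  refine ⟨C, fun y hy => ?_⟩
  rw [← hspan, Submodule.mem_span_range_iff_exists_fun] at hy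
  obtain ⟨c, rfl⟩ := hy
  -- Rounding down the coefficients in a basis of the span taken from the lattice leaves an error
  -- bounded by the sizes of the basis vectors.
  refine ⟨∑ i, ⌊c i⌋ • m i, sum_mem fun i _ => zsmul_mem (hm i) _, fun j => ?_⟩
  have e : (∑ i, c i • f i) j - ((∑ i, ⌊c i⌋ • m i) j : ℤ) = ∑ i, Int.fract (c i) * f i j := by
    simp only [Finset.sum_apply, Pi.smul_apply, smul_eq_mul, Int.cast_sum, Int.cast_mul,
      ← Finset.sum_sub_distrib]
    refine Finset.sum_congr rfl fun i _ => ?_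
    rw [← hmf i, Int.fract, sub_mul]
    rfl
  rw [e]
  calc |∑ i, Int.fract (c i) * f i j| ≤ ∑ i, |f i j| := by
        refine (Finset.abs_sum_le_sum_abs _ _).trans (Finset.sum_le_sum fun i _ => ?_)
        rw [abs_mul, abs_of_nonneg (Int.fract_nonneg _)]
        exact mul_le_of_le_one_left (abs_nonneg _) (Int.fract_lt_one _).le
    _ ≤ ∑ j, ∑ i, |f i j| :=
        Finset.single_le_sum (f := fun j => ∑ i, |f i j|)
          (fun j _ => Finset.sum_nonneg fun i _ => abs_nonneg _) (Finset.mem_univ j)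
    _ ≤ C := hC

theorem realSlice_isBounded (h : ∀ p, (slice M p I).Finite) :
    Bornology.IsBounded (realSlice M p I) := by
  classical
  obtain ⟨C, hC⟩ := exists_near_lattice M
  -- Moving the base point by `C` into the orthant absorbs the rounding error, so `p' + m` lies in
  -- the slice through `p'`, within `2 * C` of `x`. This slice may belong to another coset, whence
  -- the finiteness hypothesis for every base point.
  let p' : Fin n → ℤ := fun j => if j ∈ I then p j - C else p j + C
  refine ((Bornology.isBounded_biUnion (h p')).2 fun q _ =>
    Metric.isBounded_closedBall (x := toReal q) (r := 2 * C)).subset ?_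
  rintro x ⟨hx, hxI⟩
  obtain ⟨m, hm, hxm⟩ := hC _ hx
  simp only [Pi.sub_apply, toReal] at hxm
  refine Set.mem_biUnion (x := p' + m) ((mem_slice_iff _ _ _).2 ⟨by simpa using hm, fun j => ?_⟩) ?_
  · have h₁ := abs_le.1 (hxm j)
    constructor
    · intro hj
      have h₂ := (hxI j).1 hj
      have : ((p j - C + m j : ℤ) : ℝ) ≤ (-1 : ℤ) := by
        push_cast
        linarith
      simpa [p', hj] using Int.cast_le.1 this
    · intro hj
      have h₂ := (hxI j).2 hj
      have : ((0 : ℤ) : ℝ) ≤ (p j + C + m j : ℤ) := by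
        push_cast
        linarith
      simpa [p', hj] using Int.cast_le.1 this
  · rw [Metric.mem_closedBall, dist_pi_le_iff (by positivity)]
    intro j
    have h₁ := abs_le.1 (hxm j)
    rw [Real.dist_eq, abs_le]
    simp only [toReal, p', Pi.add_apply]
    split_ifs <;> push_cast <;> constructor <;> linarith

lemma coordBound_le_iff (h : (slice M p I).Finite) (j : Fin n) (l : ℕ) :
    coordBound M p I j ≤ l ↔ ∀ q ∈ slice M p I, -l ≤ q j := by
  have hb := (h.image fun q : Fin n → ℤ => q j).bddBelow
  rw [coordBound, max_le_iff, and_iff_right (by positivity), neg_le]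
  constructor
  · exact fun hl q hq => hl.trans (csInf_le hb ⟨q, hq, rfl⟩)
  · intro hl
    obtain hs | hs := (slice M p I).eq_empty_or_nonempty
    -- For an empty slice the convention `sInf ∅ = 0` in `ℤ` gives the bound.
    · simp [hs]
    · refine le_csInf (hs.image _) ?_
      rintro _ ⟨q, hq, rfl⟩
      exact hl q hq

end Slices

end

end CoarseLC

/-! ### Slices by the kernel of `φ`, and the main theorem -/

namespace CoarseLC

section

variable {k : Type u} [Field k] {n : ℕ} {B : Ideal (MvPolynomial (Fin n) k)}
  {D : Type*} [AddCommGroup D] (φ : (Fin n → ℤ) →+ D)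

lemma mem_slice_ker_iff {p q : Fin n → ℤ} {I : Finset (Fin n)} :
    q ∈ slice φ.ker p I ↔ φ q = φ p ∧ negSupport q = I := by
  rw [mem_slice_iff_negSupport, AddMonoidHom.mem_ker, map_sub, sub_eq_zero]

/-- Every point of the slice is a degree over `φ p` in which local cohomology is nonzero, and a
finite-dimensional direct sum has finitely many nonzero summands. -/
theorem slice_finite (hB : IsSquarefreeMonomialIdeal B) {i : ℕ}
    (hfin : ∀ δ : D, Module.Finite k (lcCoarse φ B i δ)) {I : Finset (Fin n)}
    (hI : I ∈ sigmaSet B i) (p : Fin n → ℤ) : (slice φ.ker p I).Finite := by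
  have := hfin (φ p)
  have h := finite_nontrivial_of_finite_directSum (k := k)
    fun q : {q // φ q = φ p} => lcPiece B i q.1
  refine (h.image Subtype.val).subset ?_
  intro q hq
  rw [mem_slice_ker_iff] at hq
  refine ⟨⟨q, hq.1⟩, (negSupport_mem_sigmaSet_iff hB i q).1 ?_, rfl⟩
  rwa [hq.2]

end

end CoarseLC

theorem mainTheorem2 {k : Type u} [Field k] {n : ℕ} {D : Type*} [AddCommGroup D]
    (φ : (Fin n → ℤ) →+ D) (hφ : Function.Surjective φ)
    (B : Ideal (MvPolynomial (Fin n) k)) (hB : CoarseLC.IsSquarefreeMonomialIdeal B) (i : ℕ)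
    (hfin : ∀ δ : D, Module.Finite k (CoarseLC.lcCoarse φ B i δ)) :
    (∀ I ∈ CoarseLC.sigmaSet B i, ∀ p : Fin n → ℤ,
      CoarseLC.IsPolyhedron (CoarseLC.realSlice φ.ker p I) ∧
      Bornology.IsBounded (CoarseLC.realSlice φ.ker p I) ∧
      CoarseLC.slice φ.ker p I =
        {q | q - p ∈ φ.ker ∧ CoarseLC.toReal q ∈ CoarseLC.realSlice φ.ker p I}) ∧
    ∀ (δ : D) (p : Fin n → ℤ), φ p = δ → ∀ l : ℕ,
      (Function.Bijective (CoarseLC.toLCCoarse φ hB l i δ) ↔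
        ∀ I ∈ CoarseLC.sigmaSet B i, ∀ j ∈ I, CoarseLC.coordBound φ.ker p I j ≤ (l : ℤ)) := by
  have hslice (I : Finset (Fin n)) (hI : I ∈ CoarseLC.sigmaSet B i) (p : Fin n → ℤ) :
      (CoarseLC.slice φ.ker p I).Finite := CoarseLC.slice_finite φ hB hfin hI p
  refine ⟨fun I hI p => ⟨CoarseLC.realSlice_isPolyhedron _ _ _,
    CoarseLC.realSlice_isBounded _ _ _ (hslice I hI), ?_⟩, ?_⟩
  · ext q
    constructor
    · exact fun hq => ⟨hq.1, (CoarseLC.toReal_mem_realSlice_iff _ _ _ hq.1).2 hq⟩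
    · exact fun hq => (CoarseLC.toReal_mem_realSlice_iff _ _ _ hq.1).1 hq.2
  · rintro _ p rfl l
    rw [CoarseLC.toLCCoarse_bijective_iff]
    constructor
    · intro h I hI j _
      rw [CoarseLC.coordBound_le_iff _ _ _ (hslice I hI p)]
      intro q hq
      rw [CoarseLC.mem_slice_ker_iff] at hq
      exact h q hq.1 (hq.2 ▸ hI) j
    · intro h q hq hI j
      -- The bounds concern only `j ∈ I`; the other coordinates of `q` are nonnegative, hence at
      -- least `-l`.
      by_cases hj : j ∈ CoarseLC.negSupport q
      · have := h _ hI j hj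
        rw [CoarseLC.coordBound_le_iff _ _ _ (hslice _ hI p)] at this
        exact this q ((CoarseLC.mem_slice_ker_iff φ).2 ⟨hq, rfl⟩)
      · have : 0 ≤ q j := by simpa [CoarseLC.negSupport] using hj
        omega
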